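/- Let $n,d\in\mathbb N$, $\mu\in(0,n]$, $q\in(0,d]$, and let $f\colon\mathbb R^n\to\mathbb R^d$ be continuous. For every set $E\subset\mathbb R^n$ define $$\Psi(E)=\lim_{\delta\to0+}\ \inf\Bigl\{\sum_{i=1}^\infty(\operatorname{diam}D_i)^\mu\,[\operatorname{diam}f(D_i)]^q\Bigr\}\in[0,\infty],$$ where, for each $\delta>0$, the infimum is taken over all sequences $(D_i)_{i\in\mathbb N}$ of compact subsets of $\mathbb R^n$ with $E\subset\bigcup_iD_i$ and $\operatorname{diam}D_i\le\delta$ for all $i$. For $s>0$ let $\mathcal H^s$ be the $s$-dimensional Hausdorff (outer) measure, $$\mathcal H^s(S)=\lim_{\alpha\to0+}\inf\Bigl\{\sum_{i=1}^\infty(\operatorname{diam}S_i)^s:\ S\subset\bigcup_iS_i,\ \operatorname{diam}S_i\le\alpha\Bigr\}.$$ Diameters are Euclidean. Then $\Psi$ is a countably subadditive set function, i.e. $\Psi(\emptyset)=0$ and $\Psi(A)\le\sum_{i=1}^\infty\Psi(E_i)$ whenever $A,E_1,E_2,\dots\subset\mathbb R^n$ and $A\subset\bigcup_iE_i$; and for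 every set $E\subset\mathbb R^n$ and every real $\lambda>0$, $$\mathcal H^q\bigl(\{y\in\mathbb R^d:\ \mathcal H^\mu(E\cap f^{-1}(y))\ge\lambda\}\bigr)\le5\,\frac{\Psi(E)}{\lambda}.$$ -/

import Mathlib

open Set Filter Topology MeasureTheory
open scoped ENNReal

/-- The infimum of `∑ (diam D_i)^μ (diam f(D_i))^q` over all sequences of compact sets `D_i`
covering `E`, each of diameter at most `δ`. Diameters are taken in `[0, ∞]`; those of the compact
sets `D_i` and `f(D_i)` are finite when `f` is continuous. -/
noncomputable def mixedPremeasure {n d : ℕ} (μ q : ℝ)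
    (f : EuclideanSpace ℝ (Fin n) → EuclideanSpace ℝ (Fin d)) (δ : ℝ)
    (E : Set (EuclideanSpace ℝ (Fin n))) : ℝ≥0∞ :=
  ⨅ (D : ℕ → Set (EuclideanSpace ℝ (Fin n))) (_ : ∀ i, IsCompact (D i)) (_ : E ⊆ ⋃ i, D i)
    (_ : ∀ i, Metric.ediam (D i) ≤ ENNReal.ofReal δ),
    ∑' i, Metric.ediam (D i) ^ μ * Metric.ediam (f '' D i) ^ q

/-- The set function `Ψ(E)`: the limit as `δ → 0+` of `mixedPremeasure μ q f δ E`, written as a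
supremum because the latter is monotone in `δ` (see `tendsto_mixedPremeasure`). -/
noncomputable def mixedPsi {n d : ℕ} (μ q : ℝ)
    (f : EuclideanSpace ℝ (Fin n) → EuclideanSpace ℝ (Fin d))
    (E : Set (EuclideanSpace ℝ (Fin n))) : ℝ≥0∞ :=
  ⨆ (δ : ℝ) (_ : 0 < δ), mixedPremeasure μ q f δ E

theorem mixedPremeasure_antitone {n d : ℕ} (μ q : ℝ)
    (f : EuclideanSpace ℝ (Fin n) → EuclideanSpace ℝ (Fin d))
    (E : Set (EuclideanSpace ℝ (Fin n))) :
    Antitone (fun δ : ℝ => mixedPremeasure μ q f δ E) := by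
  intro a b hab
  refine le_iInf fun D => le_iInf fun hc => le_iInf fun hE => le_iInf fun hD => ?_
  exact iInf_le_of_le D (iInf_le_of_le hc (iInf_le_of_le hE (iInf_le_of_le
    (fun i => (hD i).trans (ENNReal.ofReal_le_ofReal hab)) le_rfl)))

/-- `Ψ(E)` is the limit of the `δ`-infima as `δ → 0+`. -/
theorem tendsto_mixedPremeasure {n d : ℕ} (μ q : ℝ)
    (f : EuclideanSpace ℝ (Fin n) → EuclideanSpace ℝ (Fin d))
    (E : Set (EuclideanSpace ℝ (Fin n))) :
    Tendsto (fun δ : ℝ => mixedPremeasure μ q f δ E) (𝓝[>] 0) (𝓝 (mixedPsi μ q f E)) := by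
  refine tendsto_order.2 ⟨fun c hc => ?_, fun c hc => ?_⟩
  · obtain ⟨δ, hδ⟩ := lt_iSup_iff.1 hc
    obtain ⟨hδ0, hδ⟩ := lt_iSup_iff.1 hδ
    filter_upwards [Ioc_mem_nhdsGT hδ0] with x hx
    exact hδ.trans_le (mixedPremeasure_antitone μ q f E hx.2)
  · filter_upwards [self_mem_nhdsWithin] with x hx
    exact (le_iSup₂_of_le (f := fun (δ : ℝ) (_ : 0 < δ) => mixedPremeasure μ q f δ E) x hx
      le_rfl).trans_lt hc

/-! If compact sets `D i` cover `E` at almost the cost `Ψ(E)`, then at each `y` whose fibre in `E`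
has `μ`-premeasure above `l`, the `D i` meeting that fibre satisfy `∑ (diam D i)^μ > l`. So the
images `f(D i)` with weights `(diam D i)^μ / l` form a fractional cover of the set of such `y`, of
`q`-cost about `Ψ(E) / l`.

It remains to turn fractional covers at all scales into a bound on Hausdorff measure. If `H^q(A)` is
finite, a Vitali argument shows that almost no point of `A` lies in arbitrarily small closed sets
`S` with `H^q(A ∩ S) > 2 (diam S)^q`; away from such points, integrating the weights against `H^q`
gives `H^q(A) ≤ 2 M` (`hausdorffMeasure_le_two_mul_of_weighted_covers_of_ne_top`). Finiteness comes
separately, with a poor constant, by moving the weights to dyadic cubes and choosing an honest cover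
at random (`exists_cells_of_weights`). Any level `l < λ` is allowed; `l = λ / 2` yields the constant
`4 ≤ 5`. -/

/-! ### Countable subadditivity of `Ψ`. -/

theorem exists_cover_of_mixedPremeasure_lt {n d : ℕ} {μ q : ℝ}
    {f : EuclideanSpace ℝ (Fin n) → EuclideanSpace ℝ (Fin d)} {δ : ℝ}
    {E : Set (EuclideanSpace ℝ (Fin n))} {a : ℝ≥0∞} (h : mixedPremeasure μ q f δ E < a) :
    ∃ D : ℕ → Set (EuclideanSpace ℝ (Fin n)), (∀ i, IsCompact (D i)) ∧ (E ⊆ ⋃ i, D i) ∧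
      (∀ i, Metric.ediam (D i) ≤ ENNReal.ofReal δ) ∧
      ∑' i, Metric.ediam (D i) ^ μ * Metric.ediam (f '' D i) ^ q < a := by
  simp only [mixedPremeasure, iInf_lt_iff] at h
  obtain ⟨D, h1, h2, h3, h4⟩ := h
  exact ⟨D, h1, h2, h3, h4⟩

theorem mixedPremeasure_le_tsum {n d : ℕ} {μ q : ℝ}
    {f : EuclideanSpace ℝ (Fin n) → EuclideanSpace ℝ (Fin d)} {δ : ℝ}
    {E : Set (EuclideanSpace ℝ (Fin n))} {D : ℕ → Set (EuclideanSpace ℝ (Fin n))}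
    (hc : ∀ i, IsCompact (D i)) (hE : E ⊆ ⋃ i, D i)
    (hD : ∀ i, Metric.ediam (D i) ≤ ENNReal.ofReal δ) :
    mixedPremeasure μ q f δ E ≤ ∑' i, Metric.ediam (D i) ^ μ * Metric.ediam (f '' D i) ^ q :=
  iInf_le_of_le D (iInf_le_of_le hc (iInf_le_of_le hE (iInf_le_of_le hD le_rfl)))

theorem mixedPremeasure_le_mixedPsi {n d : ℕ} {μ q : ℝ}
    {f : EuclideanSpace ℝ (Fin n) → EuclideanSpace ℝ (Fin d)} {δ : ℝ} (hδ : 0 < δ)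
    (E : Set (EuclideanSpace ℝ (Fin n))) : mixedPremeasure μ q f δ E ≤ mixedPsi μ q f E :=
  le_iSup₂_of_le (f := fun (δ : ℝ) (_ : 0 < δ) => mixedPremeasure μ q f δ E) δ hδ le_rfl

theorem mixedPsi_empty {n d : ℕ} {μ : ℝ} (q : ℝ) (hμ : 0 < μ)
    (f : EuclideanSpace ℝ (Fin n) → EuclideanSpace ℝ (Fin d)) : mixedPsi μ q f ∅ = 0 := by
  refine le_antisymm (iSup₂_le fun δ _ => ?_) bot_le
  refine (mixedPremeasure_le_tsum (D := fun _ => ∅) (by simp) (by simp) (by simp)).trans ?_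
  simp [ENNReal.zero_rpow_of_pos hμ]

theorem mixedPremeasure_le_tsum_of_subset {n d : ℕ} {μ q : ℝ}
    {f : EuclideanSpace ℝ (Fin n) → EuclideanSpace ℝ (Fin d)} {δ : ℝ}
    {A : Set (EuclideanSpace ℝ (Fin n))} {E : ℕ → Set (EuclideanSpace ℝ (Fin n))}
    (hA : A ⊆ ⋃ i, E i) : mixedPremeasure μ q f δ A ≤ ∑' i, mixedPremeasure μ q f δ (E i) := by
  refine ENNReal.le_of_forall_pos_le_add fun ε hε hfin => ?_
  obtain ⟨e, he, hsum⟩ := ENNReal.exists_pos_sum_of_countable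
    (ENNReal.coe_ne_zero.2 hε.ne') ℕ
  have hlt : ∀ i, mixedPremeasure μ q f δ (E i) < mixedPremeasure μ q f δ (E i) + e i := fun i =>
    ENNReal.lt_add_right (ENNReal.ne_top_of_tsum_ne_top hfin.ne i)
      (ENNReal.coe_ne_zero.2 (he i).ne')
  choose D hc hE hD hs using fun i => exists_cover_of_mixedPremeasure_lt (hlt i)
  have key := mixedPremeasure_le_tsum (μ := μ) (q := q) (f := f) (δ := δ) (E := A)
    (D := fun k => D (Nat.unpair k).1 (Nat.unpair k).2) (fun k => hc _ _) (fun x hx => by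
      obtain ⟨i, hi⟩ := mem_iUnion.1 (hA hx)
      obtain ⟨j, hj⟩ := mem_iUnion.1 (hE i hi)
      exact mem_iUnion.2 ⟨Nat.pair i j, by simpa using hj⟩) (fun k => hD _ _)
  refine key.trans ?_
  rw [← Nat.pairEquiv.tsum_eq]
  simp only [Nat.pairEquiv_apply, Function.uncurry_def, Nat.unpair_pair]
  rw [ENNReal.tsum_prod (f := fun i j =>
    Metric.ediam (D i j) ^ μ * Metric.ediam (f '' D i j) ^ q)]
  calc _ ≤ ∑' i, (mixedPremeasure μ q f δ (E i) + e i) := ENNReal.tsum_le_tsum fun i => (hs i).le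
    _ = _ := ENNReal.tsum_add
    _ ≤ _ := by gcongr

theorem mixedPsi_le_tsum_of_subset {n d : ℕ} {μ q : ℝ}
    {f : EuclideanSpace ℝ (Fin n) → EuclideanSpace ℝ (Fin d)}
    {A : Set (EuclideanSpace ℝ (Fin n))} {E : ℕ → Set (EuclideanSpace ℝ (Fin n))}
    (hA : A ⊆ ⋃ i, E i) : mixedPsi μ q f A ≤ ∑' i, mixedPsi μ q f (E i) :=
  iSup₂_le fun _ hδ => (mixedPremeasure_le_tsum_of_subset hA).trans
    (ENNReal.tsum_le_tsum fun _ => mixedPremeasure_le_mixedPsi hδ _)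

/-! ### From fractional covers to honest covers by dyadic cubes. -/

/-- Fractional covers by the cells of a nested sequence of partitions can be replaced by
honest covers of no greater cost: average over the level at which the accumulated weight is
exceeded. -/
theorem exists_cells_of_weights {X ι : Type*} [Countable ι] (π : ℕ → X → ι)
    (hπ : ∀ j k x y, j ≤ k → π k x = π k y → π j x = π j y) (w : ℕ → ι → ℝ≥0∞) (ρ : ℕ → ℝ≥0∞)
    (A : Set X) (hA : ∀ x ∈ A, 1 ≤ ∑' k, w k (π k x)) :
    ∃ F : Set (ℕ × ι), (∀ p ∈ F, w p.1 p.2 ≠ 0) ∧ (∀ x ∈ A, ∃ k, (k, π k x) ∈ F) ∧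
      ∑' p, F.indicator (fun p => ρ p.1) p ≤ ∑' p : ℕ × ι, w p.1 p.2 * ρ p.1 := by
  classical
  -- `V p` is the weight of the strictly coarser cells containing the cell `p`; by nesting it does
  -- not depend on the chosen point. The value `∞` keeps empty cells from ever being selected.
  set V : ℕ × ι → ℝ≥0∞ := fun p =>
    if h : ∃ x, π p.1 x = p.2 then ∑ j ∈ Finset.range p.1, w j (π j h.choose) else ∞ with hV
  have hVx : ∀ k x, V (k, π k x) = ∑ j ∈ Finset.range k, w j (π j x) := by
    intro k x
    have h : ∃ y, π k y = π k x := ⟨x, rfl⟩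
    simp only [hV]
    rw [dif_pos h]
    refine Finset.sum_congr rfl fun j hj => ?_
    rw [hπ j k _ x (Finset.mem_range.1 hj).le h.choose_spec]
  -- `F t` selects the cells at which the accumulated weight passes `t`. For `t` uniform in `(0,
  -- 1)`, a cell is selected with probability at most its weight, so some `t < 1` costs no more than
  -- the weighted sum.
  set F : ℝ → Set (ℕ × ι) := fun t =>
    {p | V p ≤ ENNReal.ofReal t ∧ ENNReal.ofReal t < V p + w p.1 p.2} with hF
  set G : ℕ × ι → Set ℝ := fun p =>
    {t | V p ≤ ENNReal.ofReal t ∧ ENNReal.ofReal t < V p + w p.1 p.2} with hG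
  have hGm : ∀ p, MeasurableSet (G p) := fun p =>
    (measurableSet_le measurable_const ENNReal.measurable_ofReal).inter
      (measurableSet_lt ENNReal.measurable_ofReal measurable_const)
  set ν : Measure ℝ := volume.restrict (Ioo 0 1) with hν
  have : IsProbabilityMeasure ν := ⟨by simp [hν]⟩
  have hGν : ∀ p, ν (G p) ≤ w p.1 p.2 := by
    intro p
    rw [hν, Measure.restrict_apply (hGm p)]
    rcases eq_or_ne (V p) ∞ with h | h
    · simp [hG, h]
    rcases eq_or_ne (w p.1 p.2) ∞ with h' | h'
    · simp [h']
    calc volume (G p ∩ Ioo 0 1) ≤ volume (Ico (V p).toReal (V p + w p.1 p.2).toReal) := by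
          refine measure_mono fun t ht => ⟨?_, ?_⟩
          · exact ENNReal.toReal_le_of_le_ofReal ht.2.1.le ht.1.1
          · exact (ENNReal.ofReal_lt_iff_lt_toReal ht.2.1.le
              (ENNReal.add_ne_top.2 ⟨h, h'⟩)).1 ht.1.2
      _ = w p.1 p.2 := by
          rw [Real.volume_Ico, ENNReal.toReal_add h h', add_sub_cancel_left,
            ENNReal.ofReal_toReal h']
  have hind : ∀ p t, (F t).indicator (fun p => ρ p.1) p = (G p).indicator (fun _ => ρ p.1) t := by
    intro p t
    by_cases h : t ∈ G p
    · rw [indicator_of_mem h, indicator_of_mem (show p ∈ F t from h)]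
    · rw [indicator_of_notMem h, indicator_of_notMem (show p ∉ F t from h)]
  have hmeas : ∀ p, Measurable fun t => (F t).indicator (fun p => ρ p.1) p := by
    intro p
    simp only [hind]
    exact measurable_const.indicator (hGm p)
  obtain ⟨t, htN, ht⟩ := exists_notMem_null_le_lintegral (μ := ν)
    (f := fun t => ∑' p, (F t).indicator (fun p => ρ p.1) p) (N := (Iio 1)ᶜ)
    (Measurable.tsum hmeas).aemeasurable (by
      rw [hν, Measure.restrict_apply measurableSet_Iio.compl]
      convert measure_empty (μ := volume)
      ext x
      simp only [compl_Iio, mem_inter_iff, mem_Ici, mem_Ioo, mem_empty_iff_false, iff_false]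
      rintro ⟨h1, -, h2⟩
      linarith)
  refine ⟨F t, ?_, ?_, ht.trans ?_⟩
  · rintro p ⟨h1, h2⟩ h0
    rw [h0, add_zero] at h2
    exact absurd h1 h2.not_ge
  · intro x hx
    have ht1 : ENNReal.ofReal t < ∑' k, w k (π k x) := by
      refine lt_of_lt_of_le ?_ (hA x hx)
      rw [ENNReal.ofReal_lt_one]
      simpa using htN
    rw [ENNReal.tsum_eq_iSup_nat, lt_iSup_iff] at ht1
    have hm := Nat.find_spec ht1
    -- The first partial sum exceeding `t` has at least one term; its last term marks the selected
    -- cell.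
    have hmin := fun m => Nat.find_min ht1 (m := m)
    generalize Nat.find ht1 = k at hm hmin
    rcases k with _ | m
    · simp at hm
    · refine ⟨m, ?_, ?_⟩
      · rw [hVx]
        exact not_lt.1 (hmin m m.lt_succ_self)
      · simpa only [hVx, Finset.sum_range_succ] using hm
  · rw [lintegral_tsum fun p => (hmeas p).aemeasurable]
    refine ENNReal.tsum_le_tsum fun p => ?_
    simp only [hind]
    rw [lintegral_indicator_const (hGm p), mul_comm]
    gcongr
    exact hGν p

/-- The index of the dyadic cube of side `2⁻ᵏ` that contains `y`. -/
noncomputable def dyadicIndex {d : ℕ} (k : ℕ) (y : EuclideanSpace ℝ (Fin d)) : Fin d → ℤ :=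
  fun j => ⌊(2 : ℝ) ^ k * y j⌋

theorem dyadicIndex_eq_of_le {d : ℕ} (j k : ℕ) (x y : EuclideanSpace ℝ (Fin d)) (hjk : j ≤ k)
    (h : dyadicIndex k x = dyadicIndex k y) : dyadicIndex j x = dyadicIndex j y := by
  obtain ⟨m, rfl⟩ := Nat.exists_eq_add_of_le hjk
  funext i
  -- The lower bounds of a coarse index can be read off the finer index, so the finer index
  -- determines it.
  have key : ∀ (z : EuclideanSpace ℝ (Fin d)) (a : ℤ),
      a ≤ dyadicIndex j z i ↔ a * 2 ^ m ≤ dyadicIndex (j + m) z i := by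
    intro z a
    simp only [dyadicIndex, Int.le_floor]
    push_cast
    rw [pow_add, mul_right_comm, mul_le_mul_iff_left₀ (by positivity)]
  exact eq_of_forall_le_iff fun a => by rw [key, key, h]

theorem ediam_dyadicIndex_fiber_le {d : ℕ} (k : ℕ) (z : Fin d → ℤ) :
    Metric.ediam {y : EuclideanSpace ℝ (Fin d) | dyadicIndex k y = z} ≤ d * 2⁻¹ ^ k := by
  refine Metric.ediam_le fun x hx y hy => ?_
  have hco : ∀ j, |x j - y j| ≤ 2⁻¹ ^ k := by
    intro j
    have h := Int.abs_sub_lt_one_of_floor_eq_floor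
      ((congrFun hx j).trans (congrFun hy j).symm)
    rw [← mul_sub, abs_mul, abs_of_pos (by positivity : (0 : ℝ) < 2 ^ k)] at h
    rw [inv_pow, ← one_div, le_div_iff₀' (by positivity)]
    exact h.le
  have hd : dist x y ≤ d * 2⁻¹ ^ k := by
    rw [EuclideanSpace.dist_eq]
    refine (Real.sqrt_le_sqrt (Finset.sum_sq_le_sq_sum_of_nonneg fun _ _ => dist_nonneg)).trans ?_
    rw [Real.sqrt_sq (Finset.sum_nonneg fun _ _ => dist_nonneg)]
    exact (Finset.sum_le_card_nsmul _ _ (2⁻¹ ^ k) fun j _ => hco j).trans_eq (by simp)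
  rw [edist_dist]
  refine (ENNReal.ofReal_le_ofReal hd).trans_eq ?_
  rw [ENNReal.ofReal_mul (by positivity), ENNReal.ofReal_pow (by positivity),
    ENNReal.ofReal_inv_of_pos (by positivity)]
  simp

theorem exists_finset_dyadicIndex_mem {d k : ℕ} {S : Set (EuclideanSpace ℝ (Fin d))}
    (hS : Metric.ediam S ≤ 2⁻¹ ^ k) :
    ∃ Z : Finset (Fin d → ℤ), Z.card ≤ 3 ^ d ∧ ∀ y ∈ S, dyadicIndex k y ∈ Z := by
  rcases S.eq_empty_or_nonempty with rfl | ⟨x, hx⟩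
  · exact ⟨∅, by simp, by simp⟩
  refine ⟨Fintype.piFinset fun j => Finset.Icc (dyadicIndex k x j - 1) (dyadicIndex k x j + 1),
    ?_, fun y hy => Fintype.mem_piFinset.2 fun j => ?_⟩
  · rw [Fintype.card_piFinset]
    simp only [Int.card_Icc]
    refine (Finset.prod_le_pow_card _ _ 3 fun j _ => ?_).trans_eq (by simp)
    omega
  · have hd : dist x y ≤ 2⁻¹ ^ k := by
      have h := (Metric.edist_le_ediam_of_mem hx hy).trans hS
      rw [edist_dist] at h
      refine (ENNReal.ofReal_le_ofReal_iff (by positivity)).1 (h.trans_eq ?_)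
      rw [ENNReal.ofReal_pow (by positivity), ENNReal.ofReal_inv_of_pos (by positivity)]
      simp
    have hj : |x j - y j| ≤ 2⁻¹ ^ k := by
      have := PiLp.norm_apply_le (x - y) j
      rw [← dist_eq_norm] at this
      exact this.trans hd
    have h1 : |(2 : ℝ) ^ k * x j - 2 ^ k * y j| ≤ 1 := by
      rw [← mul_sub, abs_mul, abs_of_pos (by positivity : (0 : ℝ) < 2 ^ k)]
      rwa [inv_pow, ← one_div, le_div_iff₀' (by positivity)] at hj
    rw [abs_le] at h1
    simp only [dyadicIndex, Finset.mem_Icc]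
    constructor
    · rw [Int.le_floor]
      push_cast
      linarith [Int.floor_le ((2 : ℝ) ^ k * x j)]
    · rw [← Int.lt_add_one_iff, Int.floor_lt]
      push_cast
      linarith [Int.lt_floor_add_one ((2 : ℝ) ^ k * x j)]

theorem exists_inv_two_pow_near {a : ℝ≥0∞} (h0 : a ≠ 0) (h1 : a ≤ 1) :
    ∃ k : ℕ, a ≤ 2⁻¹ ^ k ∧ 2⁻¹ ^ k ≤ 2 * a := by
  have ht : a ≠ ∞ := ne_top_of_le_ne_top ENNReal.one_ne_top h1
  have h2 : ∀ k : ℕ, ENNReal.ofReal (2⁻¹ ^ k) = 2⁻¹ ^ k := fun k => by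
    rw [ENNReal.ofReal_pow (by positivity), ENNReal.ofReal_inv_of_pos (by positivity)]
    simp
  obtain ⟨k, hk1, hk2⟩ := exists_nat_pow_near_of_lt_one (y := (2⁻¹ : ℝ))
    (ENNReal.toReal_pos h0 ht) (ENNReal.toReal_le_of_le_ofReal zero_le_one (by simpa using h1))
    (by norm_num) (by norm_num)
  refine ⟨k, ?_, ?_⟩
  · rw [← h2, ← ENNReal.ofReal_toReal ht]
    exact ENNReal.ofReal_le_ofReal hk2
  · rw [← h2, ← ENNReal.ofReal_toReal ht, ← ENNReal.ofReal_ofNat 2,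
      ← ENNReal.ofReal_mul zero_le_two]
    refine ENNReal.ofReal_le_ofReal ?_
    rw [pow_succ] at hk1
    linarith

/-- Fractional covers by sets of small diameter yield covers by dyadic cubes. -/
theorem exists_dyadic_cover_of_weighted_cover {d : ℕ} {q : ℝ} (hq : 0 < q)
    {A : Set (EuclideanSpace ℝ (Fin d))} {δ : ℝ≥0∞} (hδ : δ ≤ 1) {c : ℕ → ℝ≥0∞}
    {S : ℕ → Set (EuclideanSpace ℝ (Fin d))} (hS : ∀ i, Metric.ediam (S i) ≤ δ)
    (hA : ∀ y ∈ A, 1 ≤ ∑' i, (S i).indicator (fun _ => c i) y) :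
    ∃ t : ℕ × (Fin d → ℤ) → Set (EuclideanSpace ℝ (Fin d)),
      (∀ p, Metric.ediam (t p) ≤ 2 * d * δ) ∧
      A \ (⋃ i ∈ {i | Metric.ediam (S i) = 0}, S i) ⊆ ⋃ p, t p ∧
      ∑' p, Metric.ediam (t p) ^ q ≤
        3 ^ d * (2 * d) ^ q * ∑' i, c i * Metric.ediam (S i) ^ q := by
  classical
  have hex : ∀ i, ∃ (k : ℕ) (Z : Finset (Fin d → ℤ)), Metric.ediam (S i) ≠ 0 →
      Z.card ≤ 3 ^ d ∧ (∀ y ∈ S i, dyadicIndex k y ∈ Z) ∧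
        2⁻¹ ^ k ≤ 2 * Metric.ediam (S i) := by
    intro i
    -- No dyadic scale is comparable to diameter zero; such sets get no cubes and are removed from
    -- `A`.
    by_cases h0 : Metric.ediam (S i) = 0
    · exact ⟨0, ∅, fun h => absurd h0 h⟩
    · obtain ⟨k, hk1, hk2⟩ := exists_inv_two_pow_near h0 ((hS i).trans hδ)
      obtain ⟨Z, hZ1, hZ2⟩ := exists_finset_dyadicIndex_mem hk1
      exact ⟨k, Z, fun _ => ⟨hZ1, hZ2, hk2⟩⟩
  choose κ Z hκZ using hex
  set P : ℕ → ℕ × (Fin d → ℤ) → Prop := fun i p =>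
    Metric.ediam (S i) ≠ 0 ∧ p.1 = κ i ∧ p.2 ∈ Z i with hP
  -- Each `S i` passes its full weight to each of at most `3 ^ d` cubes of comparable size.
  set w : ℕ → (Fin d → ℤ) → ℝ≥0∞ := fun k z => ∑' i, if P i (k, z) then c i else 0 with hw
  set N := ⋃ i ∈ {i | Metric.ediam (S i) = 0}, S i with hN
  obtain ⟨F, hF0, hFA, hFs⟩ := exists_cells_of_weights dyadicIndex dyadicIndex_eq_of_le w
    (fun k => (d * 2⁻¹ ^ k : ℝ≥0∞) ^ q) (A \ N) (by
      rintro y ⟨hyA, hyN⟩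
      refine (hA y hyA).trans ?_
      rw [ENNReal.tsum_comm]
      refine ENNReal.tsum_le_tsum fun i => ?_
      by_cases hy : y ∈ S i
      · have h0 : Metric.ediam (S i) ≠ 0 := fun h0 => hyN (mem_biUnion (x := i) h0 hy)
        rw [indicator_of_mem hy]
        refine le_trans ?_ (ENNReal.le_tsum (κ i))
        rw [if_pos ⟨h0, rfl, (hκZ i h0).2.1 y hy⟩]
      · rw [indicator_of_notMem hy]
        exact bot_le)
  refine ⟨fun p => if p ∈ F then {y | dyadicIndex p.1 y = p.2} else ∅, fun p => ?_, ?_, ?_⟩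
  · beta_reduce
    split_ifs with hp
    · have := hF0 p hp
      simp only [hw, ne_eq, ENNReal.tsum_eq_zero, not_forall, ite_eq_right_iff] at this
      obtain ⟨i, hi, -⟩ := this
      refine (ediam_dyadicIndex_fiber_le _ _).trans ?_
      have hk : (2⁻¹ : ℝ≥0∞) ^ p.1 ≤ 2 * δ := by
        have h1 : p.1 = κ i := hi.2.1
        rw [h1]
        exact (hκZ i hi.1).2.2.trans (by gcongr; exact hS i)
      calc (d : ℝ≥0∞) * 2⁻¹ ^ p.1 ≤ d * (2 * δ) := by gcongr
        _ = 2 * d * δ := by ring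
    · simp
  · intro y hy
    obtain ⟨k, hk⟩ := hFA y hy
    refine mem_iUnion.2 ⟨(k, dyadicIndex k y), ?_⟩
    rw [if_pos hk]
    rfl
  · calc _ ≤ ∑' p, F.indicator (fun p => (d * 2⁻¹ ^ p.1 : ℝ≥0∞) ^ q) p := by
          refine ENNReal.tsum_le_tsum fun p => ?_
          beta_reduce
          by_cases hp : p ∈ F
          · rw [if_pos hp, indicator_of_mem hp]
            exact ENNReal.rpow_le_rpow (ediam_dyadicIndex_fiber_le _ _) hq.le
          · rw [if_neg hp, Metric.ediam_empty, ENNReal.zero_rpow_of_pos hq]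
            exact bot_le
      _ ≤ _ := hFs
      _ = ∑' i, ∑' p, (if P i p then c i else 0) * (d * 2⁻¹ ^ p.1 : ℝ≥0∞) ^ q := by
          rw [ENNReal.tsum_comm]
          refine tsum_congr fun p => ?_
          rw [ENNReal.tsum_mul_right]
      _ ≤ ∑' i, 3 ^ d * (2 * d) ^ q * (c i * Metric.ediam (S i) ^ q) := by
          refine ENNReal.tsum_le_tsum fun i => ?_
          by_cases h0 : Metric.ediam (S i) = 0
          · simp [hP, h0]
          obtain ⟨hZ1, hZ2, hk⟩ := hκZ i h0
          rw [tsum_eq_sum (s := (Z i).map ⟨fun z => (κ i, z), fun a b h => (Prod.mk.inj h).2⟩)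
            (by
              rintro ⟨k, z⟩ hkz
              rw [if_neg, zero_mul]
              rintro ⟨-, h1, h2⟩
              refine hkz (Finset.mem_map.2 ⟨z, h2, ?_⟩)
              exact Prod.ext (Eq.symm h1) rfl)]
          rw [Finset.sum_map]
          calc _ ≤ (Z i).card • (c i * (2 * d * Metric.ediam (S i)) ^ q) := by
                refine Finset.sum_le_card_nsmul _ _ _ fun z _ => ?_
                refine mul_le_mul' (by split_ifs <;> simp) (ENNReal.rpow_le_rpow ?_ hq.le)
                calc (d : ℝ≥0∞) * 2⁻¹ ^ κ i ≤ d * (2 * Metric.ediam (S i)) := by gcongr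
                  _ = _ := by ring
            _ ≤ (3 ^ d : ℕ) • (c i * (2 * d * Metric.ediam (S i)) ^ q) := by gcongr
            _ = _ := by
                rw [ENNReal.mul_rpow_of_nonneg _ _ hq.le, nsmul_eq_mul]
                push_cast
                ring
      _ = _ := ENNReal.tsum_mul_left

/-- The discarded sets of diameter zero are countably many points at most, hence null as `q > 0`.
The constant is crude: the bound serves only to show that `H^q(A)` is finite. -/
theorem hausdorffMeasure_le_const_mul_of_weighted_covers {d : ℕ} {q : ℝ} (hq : 0 < q)
    {A : Set (EuclideanSpace ℝ (Fin d))} {M : ℝ≥0∞}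
    (hA : ∀ δ : ℝ≥0∞, 0 < δ → ∃ (c : ℕ → ℝ≥0∞) (S : ℕ → Set (EuclideanSpace ℝ (Fin d))),
      (∀ i, Metric.ediam (S i) ≤ δ) ∧ (∀ y ∈ A, 1 ≤ ∑' i, (S i).indicator (fun _ => c i) y) ∧
      ∑' i, c i * Metric.ediam (S i) ^ q ≤ M) :
    Measure.hausdorffMeasure q A ≤ 3 ^ d * (2 * d) ^ q * M := by
  choose c S hS hSA hM using fun m : ℕ => hA ((m : ℝ≥0∞) + 1)⁻¹
    (ENNReal.inv_pos.2 (ENNReal.add_ne_top.2 ⟨ENNReal.natCast_ne_top m, ENNReal.one_ne_top⟩))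
  have hle : ∀ m : ℕ, ((m : ℝ≥0∞) + 1)⁻¹ ≤ 1 := fun m => ENNReal.inv_le_one.2 (by simp)
  choose t ht htA hts using fun m =>
    exists_dyadic_cover_of_weighted_cover hq (hle m) (hS m) (hSA m)
  set N : Set (EuclideanSpace ℝ (Fin d)) :=
    ⋃ m, ⋃ i ∈ {i | Metric.ediam (S m i) = 0}, S m i with hN
  have hN0 : Measure.hausdorffMeasure q N = 0 := by
    have := Measure.nullSingletonClass_hausdorff (X := EuclideanSpace ℝ (Fin d)) hq
    refine Set.Countable.measure_zero ?_ _
    exact countable_iUnion fun m => (Set.to_countable _).biUnion fun i hi =>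
      (Metric.ediam_eq_zero_iff.1 hi).countable
  calc Measure.hausdorffMeasure q A ≤ Measure.hausdorffMeasure q (N ∪ A \ N) :=
        measure_mono (by rw [union_sdiff_self]; exact subset_union_right)
    _ ≤ Measure.hausdorffMeasure q N + Measure.hausdorffMeasure q (A \ N) := measure_union_le _ _
    _ = Measure.hausdorffMeasure q (A \ N) := by rw [hN0, zero_add]
    _ ≤ liminf (fun m => ∑' p, Metric.ediam (t m p) ^ q) atTop := by
        refine Measure.hausdorffMeasure_le_liminf_tsum q _
          (fun m : ℕ => 2 * d * ((m : ℝ≥0∞) + 1)⁻¹) ?_ t (Eventually.of_forall ht)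
          (Eventually.of_forall fun m => Subset.trans ?_ (htA m))
        · have h := ENNReal.Tendsto.const_mul (a := (2 * d : ℝ≥0∞))
            ((tendsto_add_atTop_iff_nat 1).2 ENNReal.tendsto_inv_nat_nhds_zero)
            (Or.inr (ENNReal.mul_ne_top ENNReal.ofNat_ne_top (ENNReal.natCast_ne_top d)))
          simpa using h
        · exact sdiff_subset_sdiff_right (subset_iUnion_of_subset m subset_rfl)
    _ ≤ liminf (fun _ : ℕ => 3 ^ d * (2 * d) ^ q * M) atTop :=
        liminf_le_liminf (Eventually.of_forall fun m => (hts m).trans (by gcongr; exact hM m))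
    _ = _ := liminf_const _

/-! ### Sets of high density and the Vitali argument. -/

/-- The size `δ` approximation of the `q`-dimensional Hausdorff measure. -/
noncomputable def hausdorffPre {X : Type*} [EMetricSpace X] (q : ℝ) (δ : ℝ≥0∞) : OuterMeasure X :=
  OuterMeasure.mkMetric'.pre (fun s => Metric.ediam s ^ q) δ

theorem hausdorffPre_anti {X : Type*} [EMetricSpace X] (q : ℝ) {δ δ' : ℝ≥0∞} (h : δ ≤ δ')
    (s : Set X) : hausdorffPre q δ' s ≤ hausdorffPre q δ s :=
  OuterMeasure.mkMetric'.mono_pre _ h s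

theorem hausdorffPre_le {X : Type*} [EMetricSpace X] (q : ℝ) {δ : ℝ≥0∞} {s : Set X}
    (h : Metric.ediam s ≤ δ) : hausdorffPre q δ s ≤ Metric.ediam s ^ q :=
  OuterMeasure.mkMetric'.pre_le h

theorem tendsto_hausdorffPre {X : Type*} [EMetricSpace X] [MeasurableSpace X] [BorelSpace X]
    (q : ℝ) (s : Set X) :
    Tendsto (fun δ => hausdorffPre q δ s) (𝓝[>] 0) (𝓝 (Measure.hausdorffMeasure q s)) := by
  rw [Measure.hausdorffMeasure, ← OuterMeasure.coe_mkMetric]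
  exact OuterMeasure.mkMetric'.tendsto_pre _ s

theorem hausdorffPre_le_hausdorffMeasure {X : Type*} [EMetricSpace X] [MeasurableSpace X]
    [BorelSpace X] (q : ℝ) {δ : ℝ≥0∞} (hδ : 0 < δ) (s : Set X) :
    hausdorffPre q δ s ≤ Measure.hausdorffMeasure q s := by
  refine ge_of_tendsto (tendsto_hausdorffPre q s) ?_
  filter_upwards [Ioc_mem_nhdsGT hδ] with δ' h
  exact hausdorffPre_anti q h.2 s

/-- The closed sets of diameter at most `δ` in which `A` has `q`-density larger than `2`. -/
def highDensitySets {X : Type*} [EMetricSpace X] [MeasurableSpace X] [BorelSpace X]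
    (q : ℝ) (A : Set X) (δ : ℝ≥0∞) : Set (Set X) :=
  {S | IsClosed S ∧ Metric.ediam S ≤ δ ∧
    2 * Metric.ediam S ^ q < Measure.hausdorffMeasure q (A ∩ S)}

theorem highDensitySets_mono {X : Type*} [EMetricSpace X] [MeasurableSpace X] [BorelSpace X]
    (q : ℝ) (A : Set X) {δ δ' : ℝ≥0∞} (h : δ ≤ δ') :
    highDensitySets q A δ ⊆ highDensitySets q A δ' :=
  fun _ hS => ⟨hS.1, hS.2.1.trans h, hS.2.2⟩

/-- A disjoint family of sets of high density is countable, and is controlled by the defect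
`μH[q] A - hausdorffPre q δ A`. -/
theorem tsum_ediam_rpow_le_of_pairwiseDisjoint {X : Type*} [EMetricSpace X] [MeasurableSpace X]
    [BorelSpace X] {q : ℝ} {A : Set X} (hA : Measure.hausdorffMeasure q A ≠ ∞) {δ : ℝ≥0∞}
    (hδ : 0 < δ) {u : Set (Set X)} (hu : u ⊆ highDensitySets q A δ) (hd : u.PairwiseDisjoint id) :
    u.Countable ∧
      hausdorffPre q δ A + ∑' S : u, Metric.ediam (S : Set X) ^ q ≤
        Measure.hausdorffMeasure q A := by
  set ν := (Measure.hausdorffMeasure q).restrict A with hν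
  have : IsFiniteMeasure ν := ⟨by rw [hν, Measure.restrict_apply_univ]; exact hA.lt_top⟩
  have hm : ∀ S : u, MeasurableSet (S : Set X) := fun S => (hu S.2).1.measurableSet
  have hdis : Pairwise (Function.onFun Disjoint fun S : u => (S : Set X)) :=
    fun S T hST => hd S.2 T.2 (Subtype.coe_injective.ne hST)
  have hνS : ∀ S : u, 2 * Metric.ediam (S : Set X) ^ q < ν S := fun S => by
    rw [hν, Measure.restrict_apply (hm S), inter_comm]
    exact (hu S.2).2.2
  have hc : Countable u := by
    rw [← Set.countable_univ_iff]
    refine (Measure.countable_meas_pos_of_disjoint_iUnion (μ := ν) hm hdis).mono fun S _ => ?_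
    exact bot_le.trans_lt (hνS S)
  refine ⟨hc, ?_⟩
  set U := ⋃ S : u, (S : Set X) with hU
  have hUm : MeasurableSet U := MeasurableSet.iUnion hm
  set σ := ∑' S : u, Metric.ediam (S : Set X) ^ q with hσ
  have h1 : 2 * σ ≤ ν U := by
    rw [hU, measure_iUnion hdis hm, hσ, ← ENNReal.tsum_mul_left]
    exact ENNReal.tsum_le_tsum fun S => (hνS S).le
  have h2 : hausdorffPre q δ U ≤ σ := (measure_iUnion_le _).trans
    (ENNReal.tsum_le_tsum fun S => hausdorffPre_le q (hu S.2).2.1)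
  -- This is where density `2` matters: covering `U` by the family costs `σ`, while `U` carries
  -- measure at least `2 * σ`, which leaves a surplus of `σ`.
  calc hausdorffPre q δ A + σ ≤ hausdorffPre q δ (U ∪ Uᶜ ∩ A) + σ := by
        gcongr
        intro x hx
        by_cases h : x ∈ U
        · exact Or.inl h
        · exact Or.inr ⟨h, hx⟩
    _ ≤ hausdorffPre q δ U + hausdorffPre q δ (Uᶜ ∩ A) + σ := by
        gcongr
        exact measure_union_le _ _
    _ ≤ σ + Measure.hausdorffMeasure q (Uᶜ ∩ A) + σ := by
        gcongr
        exact hausdorffPre_le_hausdorffMeasure q hδ _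
    _ = 2 * σ + ν Uᶜ := by
        rw [hν, Measure.restrict_apply hUm.compl]
        ring
    _ ≤ ν U + ν Uᶜ := by gcongr
    _ = Measure.hausdorffMeasure q A := by
        rw [measure_add_measure_compl hUm, hν, Measure.restrict_apply_univ]

theorem hausdorffPre_sUnion_highDensitySets_le {X : Type*} [MetricSpace X] [MeasurableSpace X]
    [BorelSpace X] {q : ℝ} (hq : 0 < q) {A : Set X} (hA : Measure.hausdorffMeasure q A ≠ ∞)
    {δ : ℝ≥0∞} (hδ : 0 < δ) (hδ' : δ ≠ ∞) :
    hausdorffPre q (5 * δ) (⋃₀ highDensitySets q A δ) ≤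
      5 ^ q * (Measure.hausdorffMeasure q A - hausdorffPre q δ A) := by
  set t := highDensitySets q A δ with ht
  have hfin : ∀ S ∈ t, Metric.ediam S ≠ ∞ := fun S hS => ne_top_of_le_ne_top hδ' hS.2.1
  obtain ⟨u, hut, hud, hu⟩ := Vitali.exists_disjoint_subfamily_covering_enlargement
    (id : Set X → Set X) t (fun S => (Metric.ediam S).toReal) 2 one_lt_two
    (fun _ _ => ENNReal.toReal_nonneg) δ.toReal
    (fun S hS => ENNReal.toReal_mono hδ' hS.2.1) (fun S hS => by
      have h := bot_le.trans_lt hS.2.2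
      exact (nonempty_of_measure_ne_zero h.ne').mono inter_subset_right)
  obtain ⟨huc, hle⟩ := tsum_ediam_rpow_le_of_pairwiseDisjoint hA hδ hut hud
  have := huc.to_subtype
  -- `H b` collects the sets that the Vitali selection charges to `b`; its diameter is at most `2 +
  -- 1 + 2 = 5` times that of `b`.
  set H : Set X → Set X := fun b =>
    ⋃₀ {S ∈ t | (S ∩ b).Nonempty ∧ Metric.ediam S ≤ 2 * Metric.ediam b} with hH
  have hHd : ∀ b, Metric.ediam (H b) ≤ 5 * Metric.ediam b := by
    intro b
    refine Metric.ediam_le ?_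
    rintro x ⟨S, ⟨-, ⟨x', hx', hxb⟩, hS⟩, hx⟩ y ⟨T, ⟨-, ⟨y', hy', hyb⟩, hT⟩, hy⟩
    calc edist x y ≤ edist x x' + edist x' y' + edist y' y := edist_triangle4 _ _ _ _
      _ ≤ 2 * Metric.ediam b + Metric.ediam b + 2 * Metric.ediam b := by
          gcongr
          · exact (Metric.edist_le_ediam_of_mem hx hx').trans hS
          · exact Metric.edist_le_ediam_of_mem hxb hyb
          · exact (Metric.edist_le_ediam_of_mem hy' hy).trans hT
      _ = 5 * Metric.ediam b := by ring
  have hcov : ⋃₀ t ⊆ ⋃ b : u, H b := by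
    rintro x ⟨S, hS, hx⟩
    obtain ⟨b, hb, hne, hSb⟩ := hu S hS
    refine mem_iUnion.2 ⟨⟨b, hb⟩, S, ⟨hS, hne, ?_⟩, hx⟩
    rw [← ENNReal.toReal_le_toReal (hfin S hS)
      (ENNReal.mul_ne_top ENNReal.ofNat_ne_top (hfin b (hut hb))), ENNReal.toReal_mul]
    exact hSb
  calc hausdorffPre q (5 * δ) (⋃₀ t) ≤ hausdorffPre q (5 * δ) (⋃ b : u, H b) := measure_mono hcov
    _ ≤ ∑' b : u, hausdorffPre q (5 * δ) (H b) := measure_iUnion_le _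
    _ ≤ ∑' b : u, 5 ^ q * Metric.ediam (b : Set X) ^ q := by
        refine ENNReal.tsum_le_tsum fun b => ?_
        refine (hausdorffPre_le q ((hHd b).trans ?_)).trans ?_
        · gcongr
          exact (hut b.2).2.1
        · rw [← ENNReal.mul_rpow_of_nonneg _ _ hq.le]
          exact ENNReal.rpow_le_rpow (hHd b) hq.le
    _ = 5 ^ q * ∑' b : u, Metric.ediam (b : Set X) ^ q := ENNReal.tsum_mul_left
    _ ≤ _ := by
        gcongr
        refine ENNReal.le_sub_of_add_le_left ?_ hle
        exact ne_top_of_le_ne_top hA (hausdorffPre_le_hausdorffMeasure q hδ A)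

theorem tendsto_inv_nat_add_one_nhdsGT :
    Tendsto (fun m : ℕ => ((m : ℝ≥0∞) + 1)⁻¹) atTop (𝓝[>] 0) := by
  refine tendsto_nhdsWithin_iff.2 ⟨?_, Eventually.of_forall fun m => ?_⟩
  · simpa using (tendsto_add_atTop_iff_nat 1).2 ENNReal.tendsto_inv_nat_nhds_zero
  · simp

/-- As `δ → 0` the defect `H^q(A) - H^q_δ(A)` tends to `0`, since `H^q(A)` is finite, and it
controls the premeasure at scale `5 * δ` of the union of the high density sets. -/
theorem hausdorffMeasure_iInter_highDensity_eq_zero {X : Type*} [MetricSpace X]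
    [MeasurableSpace X] [BorelSpace X] {q : ℝ} (hq : 0 < q) {A : Set X}
    (hA : Measure.hausdorffMeasure q A ≠ ∞) :
    Measure.hausdorffMeasure q (⋂ m : ℕ, ⋃₀ highDensitySets q A ((m : ℝ≥0∞) + 1)⁻¹) = 0 := by
  have hpos : ∀ m : ℕ, 0 < ((m : ℝ≥0∞) + 1)⁻¹ := fun m => by simp
  have h5 : Tendsto (fun m : ℕ => 5 * ((m : ℝ≥0∞) + 1)⁻¹) atTop (𝓝[>] 0) := by
    refine tendsto_nhdsWithin_iff.2 ⟨?_, Eventually.of_forall fun m => ?_⟩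
    · have h := ENNReal.Tendsto.const_mul (a := 5)
        (tendsto_nhdsWithin_iff.1 tendsto_inv_nat_add_one_nhdsGT).1 (Or.inr ENNReal.ofNat_ne_top)
      rwa [mul_zero] at h
    · exact ENNReal.mul_pos (by norm_num) (hpos m).ne'
  refine le_antisymm ?_ bot_le
  have hlim : Tendsto (fun m : ℕ => (5 : ℝ≥0∞) ^ q * (Measure.hausdorffMeasure q A -
      hausdorffPre q ((m : ℝ≥0∞) + 1)⁻¹ A)) atTop (𝓝 0) := by
    have h := ENNReal.Tendsto.const_mul (a := (5 : ℝ≥0∞) ^ q) (ENNReal.Tendsto.sub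
      tendsto_const_nhds ((tendsto_hausdorffPre q A).comp tendsto_inv_nat_add_one_nhdsGT)
      (Or.inl hA)) (Or.inr (ENNReal.rpow_ne_top_of_nonneg hq.le ENNReal.ofNat_ne_top))
    rwa [tsub_self, mul_zero] at h
  refine le_of_tendsto_of_tendsto' ((tendsto_hausdorffPre q _).comp h5) hlim fun m => ?_
  refine (measure_mono (iInter_subset _ m)).trans ?_
  exact hausdorffPre_sUnion_highDensitySets_le hq hA (hpos m) (by simp)

/-! ### Fractional covers bound Hausdorff measure with factor `2`. -/

theorem hausdorffMeasure_le_two_mul_of_weighted_covers_of_ne_top {X : Type*} [MetricSpace X]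
    [MeasurableSpace X] [BorelSpace X] {q : ℝ} (hq : 0 < q) {A : Set X}
    (hfin : Measure.hausdorffMeasure q A ≠ ∞) {M : ℝ≥0∞}
    (hA : ∀ δ : ℝ≥0∞, 0 < δ → ∃ (c : ℕ → ℝ≥0∞) (S : ℕ → Set X), (∀ i, IsClosed (S i)) ∧
      (∀ i, Metric.ediam (S i) ≤ δ) ∧ (∀ y ∈ A, 1 ≤ ∑' i, (S i).indicator (fun _ => c i) y) ∧
      ∑' i, c i * Metric.ediam (S i) ^ q ≤ M) :
    Measure.hausdorffMeasure q A ≤ 2 * M := by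
  set B : ℕ → Set X := fun m => ⋃₀ highDensitySets q A ((m : ℝ≥0∞) + 1)⁻¹ with hB
  have hBanti : Antitone B := fun m k hmk =>
    sUnion_subset_sUnion (highDensitySets_mono q A (by gcongr))
  have hmono : Monotone fun m => A \ B m := fun m k hmk => sdiff_subset_sdiff_right (hBanti hmk)
  have hcov : A ⊆ (⋂ m, B m) ∪ ⋃ m, A \ B m := fun x hx => by
    by_cases h : ∃ m, x ∉ B m
    · obtain ⟨m, hm⟩ := h
      exact Or.inr (mem_iUnion.2 ⟨m, hx, hm⟩)
    · push Not at h
      exact Or.inl (mem_iInter.2 h)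
  refine (measure_mono hcov).trans ((measure_union_le _ _).trans ?_)
  -- Continuity from below along an increasing sequence needs no measurability, so `A` may be
  -- arbitrary.
  rw [hausdorffMeasure_iInter_highDensity_eq_zero hq hfin, zero_add, hmono.measure_iUnion]
  refine iSup_le fun m => ?_
  obtain ⟨c, S, hSc, hSd, hSA, hM⟩ := hA ((m : ℝ≥0∞) + 1)⁻¹ (by simp)
  set ν := (Measure.hausdorffMeasure q).restrict (A \ B m) with hν
  have hgi : ∀ i, Measurable ((S i).indicator fun _ => c i) := fun i =>
    measurable_const.indicator (hSc i).measurableSet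
  have hg : Measurable fun y => ∑' i, (S i).indicator (fun _ => c i) y := Measurable.tsum hgi
  calc Measure.hausdorffMeasure q (A \ B m) = ∫⁻ _, 1 ∂ν := by
        rw [lintegral_one, hν, Measure.restrict_apply_univ]
    _ ≤ ∫⁻ y, ∑' i, (S i).indicator (fun _ => c i) y ∂ν := by
        refine lintegral_mono_ae ?_
        rw [hν, ae_restrict_iff (measurableSet_le measurable_const hg)]
        exact Eventually.of_forall fun y hy => hSA y hy.1
    _ = ∑' i, c i * ν (S i) := by
        rw [lintegral_tsum fun i => (hgi i).aemeasurable]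
        exact tsum_congr fun i => lintegral_indicator_const (hSc i).measurableSet _
    _ ≤ ∑' i, 2 * (c i * Metric.ediam (S i) ^ q) := by
        refine ENNReal.tsum_le_tsum fun i => ?_
        rw [mul_left_comm]
        gcongr
        rw [hν, Measure.restrict_apply (hSc i).measurableSet]
        -- A set `S i` containing a point outside `B m` cannot have high density.
        rcases (S i ∩ (A \ B m)).eq_empty_or_nonempty with h | ⟨x, hxS, hxA, hxB⟩
        · simp [h]
        · refine (measure_mono (t := A ∩ S i) fun y hy => ⟨hy.2.1, hy.1⟩).trans ?_
          by_contra! hlt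
          exact hxB ⟨S i, ⟨hSc i, hSd i, hlt⟩, hxS⟩
    _ = 2 * ∑' i, c i * Metric.ediam (S i) ^ q := ENNReal.tsum_mul_left
    _ ≤ 2 * M := by gcongr

theorem hausdorffMeasure_le_two_mul_of_weighted_covers {d : ℕ} {q : ℝ} (hq : 0 < q)
    {A : Set (EuclideanSpace ℝ (Fin d))} {M : ℝ≥0∞}
    (hA : ∀ δ : ℝ≥0∞, 0 < δ → ∃ (c : ℕ → ℝ≥0∞) (S : ℕ → Set (EuclideanSpace ℝ (Fin d))),
      (∀ i, IsClosed (S i)) ∧ (∀ i, Metric.ediam (S i) ≤ δ) ∧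
      (∀ y ∈ A, 1 ≤ ∑' i, (S i).indicator (fun _ => c i) y) ∧
      ∑' i, c i * Metric.ediam (S i) ^ q ≤ M) :
    Measure.hausdorffMeasure q A ≤ 2 * M := by
  rcases eq_or_ne M ∞ with rfl | hM
  · simp
  refine hausdorffMeasure_le_two_mul_of_weighted_covers_of_ne_top hq ?_ hA
  refine ne_top_of_le_ne_top ?_ (hausdorffMeasure_le_const_mul_of_weighted_covers (M := M) hq
    fun δ hδ => ?_)
  · exact ENNReal.mul_ne_top (ENNReal.mul_ne_top (ENNReal.pow_ne_top ENNReal.ofNat_ne_top)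
      (ENNReal.rpow_ne_top_of_nonneg hq.le
        (ENNReal.mul_ne_top ENNReal.ofNat_ne_top (ENNReal.natCast_ne_top d)))) hM
  · obtain ⟨c, S, -, h⟩ := hA δ hδ
    exact ⟨c, S, h⟩

/-! ### Fibres of `f` and the final estimate. -/

/-- Uniform continuity on balls: small sets meeting a fixed ball have small images. -/
theorem exists_forall_ediam_image_le {X Y : Type*} [MetricSpace X] [ProperSpace X]
    [MetricSpace Y] {f : X → Y} (hf : Continuous f) (x₀ : X) (R : ℝ) {δ a : ℝ≥0∞}
    (hδ : 0 < δ) (ha : 0 < a) :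
    ∃ r : ℝ, 0 < r ∧ ENNReal.ofReal r ≤ a ∧ ∀ D : Set X, Metric.ediam D ≤ ENNReal.ofReal r →
      (D ∩ Metric.ball x₀ R).Nonempty → Metric.ediam (f '' D) ≤ δ := by
  have huc := (isCompact_closedBall x₀ (R + 1)).uniformContinuousOn_of_continuous hf.continuousOn
  obtain ⟨e, he, hfe⟩ := EMetric.uniformContinuousOn_iff.1 huc δ hδ
  obtain ⟨r, hr0, hr⟩ := ENNReal.lt_iff_exists_nnreal_btwn.1
    (lt_min (lt_min he ha) (zero_lt_one (α := ℝ≥0∞)))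
  simp only [lt_min_iff] at hr
  refine ⟨r, by simpa using hr0, by simpa using hr.1.2.le, fun D hD ⟨x, hxD, hx⟩ => ?_⟩
  rw [ENNReal.ofReal_coe_nnreal] at hD
  have hDsub : D ⊆ Metric.closedBall x₀ (R + 1) := by
    intro y hy
    have h1 : edist y x ≤ ENNReal.ofReal 1 := by
      simpa using ((Metric.edist_le_ediam_of_mem hy hxD).trans hD).trans hr.2.le
    rw [edist_le_ofReal zero_le_one] at h1
    rw [Metric.mem_closedBall]
    linarith [dist_triangle y x x₀, Metric.mem_ball.1 hx]
  refine Metric.ediam_le ?_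
  rintro _ ⟨y, hy, rfl⟩ _ ⟨z, hz, rfl⟩
  exact (hfe (hDsub hy) (hDsub hz)
    (((Metric.edist_le_ediam_of_mem hy hz).trans hD).trans_lt hr.1.1)).le

/-- Restricting to a ball makes `f` uniformly continuous, so fine covers of `E` have images of small
diameter, as the fractional covers require. -/
theorem hausdorffMeasure_setOf_lt_hausdorffPre_le {n d : ℕ} {μ q : ℝ} (hμ : 0 < μ) (hq : 0 < q)
    {f : EuclideanSpace ℝ (Fin n) → EuclideanSpace ℝ (Fin d)} (hf : Continuous f)
    (E : Set (EuclideanSpace ℝ (Fin n))) {a : ℝ≥0∞} (ha : 0 < a) (R : ℝ) {l : ℝ≥0∞}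
    (hl : l ≠ 0) (hl' : l ≠ ∞) :
    Measure.hausdorffMeasure q {y : EuclideanSpace ℝ (Fin d) |
      l < hausdorffPre μ a (E ∩ Metric.ball 0 R ∩ f ⁻¹' {y})} ≤ 2 * (mixedPsi μ q f E / l) := by
  classical
  rcases eq_or_ne (mixedPsi μ q f E) ∞ with htop | hfin
  · rw [htop, ENNReal.top_div_of_ne_top hl', ENNReal.mul_top two_ne_zero]
    exact le_top
  refine ENNReal.le_of_forall_pos_le_add fun e he _ => ?_
  have hη : ((e / 2 : NNReal) : ℝ≥0∞) * l ≠ 0 := by simp [he.ne', hl]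
  have hM : 2 * ((mixedPsi μ q f E + ((e / 2 : NNReal) : ℝ≥0∞) * l) / l) =
      2 * (mixedPsi μ q f E / l) + e := by
    rw [ENNReal.add_div, mul_div_assoc, ENNReal.div_self hl hl', mul_one, mul_add]
    congr 1
    rw [← ENNReal.coe_ofNat, ← ENNReal.coe_mul, mul_div_cancel₀ _ two_ne_zero]
  rw [← hM]
  refine hausdorffMeasure_le_two_mul_of_weighted_covers hq fun δ hδ => ?_
  obtain ⟨r, hr, hra, hD⟩ := exists_forall_ediam_image_le hf 0 R hδ ha
  obtain ⟨D, hDc, hDE, hDr, hDs⟩ := exists_cover_of_mixedPremeasure_lt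
    ((mixedPremeasure_le_mixedPsi hr E).trans_lt (ENNReal.lt_add_right hfin hη))
  -- Pieces missing the ball are emptied, since nothing bounds the diameters of their images.
  set D' : ℕ → Set (EuclideanSpace ℝ (Fin n)) := fun i =>
    if (D i ∩ Metric.ball 0 R).Nonempty then D i else ∅ with hD'
  have hD'sub : ∀ i, D' i ⊆ D i := fun i => by
    simp only [hD']
    split_ifs
    exacts [subset_rfl, empty_subset _]
  refine ⟨fun i => Metric.ediam (D' i) ^ μ / l, fun i => f '' D' i, fun i => ?_, fun i => ?_,
    fun y hy => ?_, ?_⟩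
  · simp only [hD']
    split_ifs
    · exact ((hDc i).image hf).isClosed
    · simp
  · simp only [hD']
    split_ifs with h
    · exact hD _ (hDr i) h
    · simp
  · have hcov : E ∩ Metric.ball 0 R ∩ f ⁻¹' {y} ⊆ ⋃ i, D' i ∩ f ⁻¹' {y} := by
      rintro x ⟨⟨hxE, hxR⟩, hxy⟩
      obtain ⟨i, hi⟩ := mem_iUnion.1 (hDE hxE)
      refine mem_iUnion.2 ⟨i, ?_, hxy⟩
      simp only [hD']
      rwa [if_pos ⟨x, hi, hxR⟩]
    have hle : l ≤ ∑' i, (f '' D' i).indicator (fun _ => Metric.ediam (D' i) ^ μ) y := by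
      refine (le_of_lt hy).trans ((measure_mono hcov).trans ((measure_iUnion_le _).trans ?_))
      refine ENNReal.tsum_le_tsum fun i => ?_
      by_cases h : y ∈ f '' D' i
      · rw [indicator_of_mem h]
        refine (measure_mono inter_subset_left).trans (hausdorffPre_le μ ?_)
        exact (Metric.ediam_mono (hD'sub i)).trans ((hDr i).trans hra)
      · have h0 : D' i ∩ f ⁻¹' {y} = ∅ := by
          ext x
          simp only [mem_inter_iff, mem_preimage, mem_singleton_iff, mem_empty_iff_false, iff_false]
          rintro ⟨hx, rfl⟩
          exact h (mem_image_of_mem f hx)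
        simp [h0]
    calc (1 : ℝ≥0∞) = l / l := (ENNReal.div_self hl hl').symm
      _ ≤ (∑' i, (f '' D' i).indicator (fun _ => Metric.ediam (D' i) ^ μ) y) / l := by gcongr
      _ = _ := by
        rw [div_eq_mul_inv, ← ENNReal.tsum_mul_right]
        refine tsum_congr fun i => ?_
        by_cases h : y ∈ f '' D' i
        · rw [indicator_of_mem h, indicator_of_mem h, ← div_eq_mul_inv]
        · rw [indicator_of_notMem h, indicator_of_notMem h, zero_mul]
  · calc _ = (∑' i, Metric.ediam (D' i) ^ μ * Metric.ediam (f '' D' i) ^ q) / l := by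
          rw [div_eq_mul_inv, ← ENNReal.tsum_mul_right]
          refine tsum_congr fun i => ?_
          simp only [div_eq_mul_inv]
          rw [mul_right_comm]
      _ ≤ (∑' i, Metric.ediam (D i) ^ μ * Metric.ediam (f '' D i) ^ q) / l := by
          refine ENNReal.div_le_div_right (ENNReal.tsum_le_tsum fun i => ?_) _
          exact mul_le_mul'
            (ENNReal.rpow_le_rpow (Metric.ediam_mono (hD'sub i)) hμ.le)
            (ENNReal.rpow_le_rpow (Metric.ediam_mono (image_mono (hD'sub i))) hq.le)
      _ ≤ _ := ENNReal.div_le_div_right hDs.le _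

theorem hausdorffMeasure_setOf_le_hausdorffMeasure_preimage_le {n d : ℕ} {μ q : ℝ} (hμ : 0 < μ)
    (hq : 0 < q) {f : EuclideanSpace ℝ (Fin n) → EuclideanSpace ℝ (Fin d)} (hf : Continuous f)
    (E : Set (EuclideanSpace ℝ (Fin n))) {b l : ℝ≥0∞} (hl : l ≠ 0) (hl' : l ≠ ∞) (hlb : l < b) :
    Measure.hausdorffMeasure q {y : EuclideanSpace ℝ (Fin d) |
      b ≤ Measure.hausdorffMeasure μ (E ∩ f ⁻¹' {y})} ≤ 2 * (mixedPsi μ q f E / l) := by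
  set G : ℕ → EuclideanSpace ℝ (Fin d) → Set (EuclideanSpace ℝ (Fin n)) := fun k y =>
    E ∩ Metric.ball 0 k ∩ f ⁻¹' {y} with hG
  have hGmono : ∀ y, Monotone fun k => G k y := fun y j k hjk => by
    refine inter_subset_inter_left _ (inter_subset_inter_right _ (Metric.ball_subset_ball ?_))
    exact_mod_cast hjk
  -- One index governs both the ball and the scale, so the sets increase and the uniform bound
  -- passes to their union. The gap `l < b` makes the strict inequality hold at some finite stage.
  set T : ℕ → Set (EuclideanSpace ℝ (Fin d)) := fun k =>
    {y | l < hausdorffPre μ ((k : ℝ≥0∞) + 1)⁻¹ (G k y)} with hT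
  have hTmono : Monotone T := fun j k hjk y hy => lt_of_lt_of_le hy
    ((measure_mono (hGmono y hjk)).trans (hausdorffPre_anti μ (by gcongr) _))
  have hcov : {y | b ≤ Measure.hausdorffMeasure μ (E ∩ f ⁻¹' {y})} ⊆ ⋃ k, T k := by
    intro y hy
    have hU : E ∩ f ⁻¹' {y} ⊆ ⋃ k, G k y := by
      rintro x ⟨hxE, hxy⟩
      obtain ⟨k, hk⟩ := exists_nat_gt (dist x 0)
      exact mem_iUnion.2 ⟨k, ⟨hxE, hk⟩, hxy⟩
    have h1 := (hlb.trans_le hy).trans_le (measure_mono hU)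
    rw [(hGmono y).measure_iUnion, lt_iSup_iff] at h1
    obtain ⟨k, hk⟩ := h1
    obtain ⟨m, hm⟩ := ((((tendsto_hausdorffPre μ (G k y)).comp
      tendsto_inv_nat_add_one_nhdsGT).eventually (lt_mem_nhds hk)).and
      (eventually_ge_atTop k)).exists
    exact mem_iUnion.2 ⟨m, hm.1.trans_le (measure_mono (hGmono y hm.2))⟩
  refine (measure_mono hcov).trans ?_
  rw [hTmono.measure_iUnion]
  exact iSup_le fun k =>
    hausdorffMeasure_setOf_lt_hausdorffPre_le hμ hq hf E (by simp) k hl hl'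

theorem theorem6p3 (n d : ℕ) (μ q : ℝ) (hμ : μ ∈ Set.Ioc (0 : ℝ) n) (hq : q ∈ Set.Ioc (0 : ℝ) d)
    (f : EuclideanSpace ℝ (Fin n) → EuclideanSpace ℝ (Fin d)) (hf : Continuous f) :
    (mixedPsi μ q f ∅ = 0 ∧
      ∀ (A : Set (EuclideanSpace ℝ (Fin n))) (E : ℕ → Set (EuclideanSpace ℝ (Fin n))),
        A ⊆ ⋃ i, E i → mixedPsi μ q f A ≤ ∑' i, mixedPsi μ q f (E i)) ∧
    ∀ (E : Set (EuclideanSpace ℝ (Fin n))) (l : ℝ), 0 < l →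
      Measure.hausdorffMeasure q {y : EuclideanSpace ℝ (Fin d) |
          ENNReal.ofReal l ≤ Measure.hausdorffMeasure μ (E ∩ f ⁻¹' {y})} ≤
        5 * (mixedPsi μ q f E / ENNReal.ofReal l) := by

  refine ⟨⟨mixedPsi_empty q hμ.1 f, fun A E hA => mixedPsi_le_tsum_of_subset hA⟩,
    fun E l hl => ?_⟩
  have h0 : ENNReal.ofReal l ≠ 0 := (ENNReal.ofReal_pos.2 hl).ne'
  refine (hausdorffMeasure_setOf_le_hausdorffMeasure_preimage_le hμ.1 hq.1 hf E
    (l := ENNReal.ofReal l / 2) (ENNReal.div_ne_zero.2 ⟨h0, ENNReal.ofNat_ne_top⟩)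
    (ENNReal.div_ne_top ENNReal.ofReal_ne_top two_ne_zero)
    (ENNReal.half_lt_self h0 ENNReal.ofReal_ne_top)).trans ?_
  calc 2 * (mixedPsi μ q f E / (ENNReal.ofReal l / 2))
      = 4 * (mixedPsi μ q f E / ENNReal.ofReal l) := by
        simp only [div_eq_mul_inv]
        rw [ENNReal.mul_inv (Or.inl h0) (Or.inl ENNReal.ofReal_ne_top), inv_inv]
        ring
    _ ≤ 5 * (mixedPsi μ q f E / ENNReal.ofReal l) := by
        gcongr
        norm_num
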